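/- Let $A$ be a finite alphabet with at least two symbols, $A^\star$ the set of finite strings over $A$ (including the empty string), and $\mathcal P$ the set of stationary ergodic probability measures on $A^{\mathbb Z}$ (product $\sigma$-algebra), with coordinates $X_i$. For $P\in\mathcal P$ and $s\in A^\star$ write $P(s)=P(X_{-|s|}^{-1}=s)$ and, if $P(s)>0$, $P(a\mid s)=P(X_0=a\mid X_{-|s|}^{-1}=s)$. A string $s$ is a context of $P$ if (1) $P(s)>0$ or $s$ is empty; (2) $P(a\mid v)=P(a\mid s)$ for all $a\in A$ and all $v\in A^\star$ with $P(v)>0$ that have $s$ as a suffix; (3) no proper suffix of $s$ satisfies (2). An infinite context is a left-infinite sequence all of whose finite suffixes (including the empty one) have positive probability and none of whose finite suffixes is a context. The context tree $\tau_P$ is the set of all finite and infinite contexts of $P$, and $\bar\tau_P\subset A^\star$, its set of nodes, is the set of all finite suffixes of elements of $\tau_P$. A functional $F:\mathcal P\to\mathcal F$ with values in a metric space $(\mathcal F,d)$ is consistently estimable on $\mathcal P$ if there are maps $F_n:A^n\to\mathcal F$ such that for every $P\in\mathcal P$, $d(F_n(X_1,\dots,X_n),F(P))\to0$ in $P$-probability.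 Theorem 2. Let $\varphi:A^\star\to[0,\infty)$ with $\sum_{v\in A^\star}\varphi(v)=\infty$. Then the real-valued functional $L(P)=\mathbf 1\{\sum_{v\in\bar\tau_P}\varphi(v)<\infty\}$ is not consistently estimable on $\mathcal P$. In particular, neither the indicator of "$P$ has a finite context tree" (that is, $\bar\tau_P$ is finite) nor the indicator of "$P$ is Markov of some finite order" is consistently estimable on $\mathcal P$. -/

import Mathlib

open MeasureTheory ProbabilityTheory Filter Topology
open scoped ENNReal NNReal

/-- The left shift on two-sided sequences. -/
def shift {A : Type*} (ω : ℤ → A) : ℤ → A := fun i => ω (i + 1)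

/-- The set `𝒫` of stationary ergodic probability measures on `A^ℤ` with the product σ-algebra.
(`Ergodic shift P` says that the shift preserves `P` and that invariant events are trivial.) -/
def StationaryErgodic (A : Type*) [MeasurableSpace A] : Type _ :=
  {P : Measure (ℤ → A) // IsProbabilityMeasure P ∧ Ergodic shift P}

/-- The event `X_{-|s|}^{-1} = s`. Finite strings are lists, the oldest symbol first, so that
`u <:+ v` says that `u` is a suffix of `v`. -/
def pastEvent {A : Type*} (s : List A) : Set (ℤ → A) :=
  {ω | ∀ (i : ℕ) (hi : i < s.length), ω ((i : ℤ) - (s.length : ℤ)) = s[i]}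

/-- `P(s)`, the stationary probability of the string `s`. -/
noncomputable def strProb {A : Type*} [MeasurableSpace A] (P : Measure (ℤ → A)) (s : List A) :
    ℝ≥0∞ :=
  P (pastEvent s)

/-- `P(a | s) = Prob(X_0 = a | X_{-|s|}^{-1} = s)`; it is used only where `P(s) > 0`. -/
noncomputable def nextProb {A : Type*} [MeasurableSpace A] (P : Measure (ℤ → A)) (s : List A)
    (a : A) : ℝ≥0∞ :=
  ProbabilityTheory.cond P (pastEvent s) {ω | ω 0 = a}

/-- The string `s` is all that matters of a past ending in `s`: for every symbol `a` and every
string `v` of positive probability having `s` as a suffix, `P(a | v) = P(a | s)`. -/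
def DeterminesNext {A : Type*} [MeasurableSpace A] (P : Measure (ℤ → A)) (s : List A) : Prop :=
  ∀ (a : A) (v : List A), s <:+ v → 0 < strProb P v → nextProb P v a = nextProb P s a

/-- The string `s` is a context of `P`. -/
def IsContext {A : Type*} [MeasurableSpace A] (P : Measure (ℤ → A)) (s : List A) : Prop :=
  (0 < strProb P s ∨ s = []) ∧ DeterminesNext P s ∧
    ∀ u : List A, u <:+ s → u ≠ s → ¬ DeterminesNext P u

/-- A left-infinite sequence `x_{-∞}^{-1}` is a function `x : ℕ → A`, with `x j` the symbol at time
`-(j + 1)`; this is its suffix `x_{-n}^{-1}` of length `n`. -/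
def pastSuffix {A : Type*} (x : ℕ → A) (n : ℕ) : List A :=
  ((List.range n).map x).reverse

/-- The left-infinite sequence `x` is an infinite context of `P`. -/
def IsInfiniteContext {A : Type*} [MeasurableSpace A] (P : Measure (ℤ → A)) (x : ℕ → A) : Prop :=
  ∀ n : ℕ, 0 < strProb P (pastSuffix x n) ∧ ¬ IsContext P (pastSuffix x n)

/-- The context tree `τ_P`: the set of all finite and infinite contexts of `P`. -/
def contextTree {A : Type*} [MeasurableSpace A] (P : Measure (ℤ → A)) :
    Set (List A ⊕ (ℕ → A)) :=
  {l | Sum.elim (IsContext P) (IsInfiniteContext P) l}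

/-- The nodes of a set `τ` of finite or left-infinite sequences: all finite suffixes of its
elements. -/
def treeNodes {A : Type*} (τ : Set (List A ⊕ (ℕ → A))) : Set (List A) :=
  {v | (∃ s : List A, Sum.inl s ∈ τ ∧ v <:+ s) ∨
    ∃ x : ℕ → A, Sum.inr x ∈ τ ∧ ∃ n : ℕ, v = pastSuffix x n}

/-- `P` has a finite context tree: the tree has finitely many nodes. -/
def HasFiniteContextTree {A : Type*} [MeasurableSpace A] (P : Measure (ℤ → A)) : Prop :=
  (treeNodes (contextTree P)).Finite

/-- `P` is a Markov chain of some finite order `k`. -/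
def IsMarkov {A : Type*} [MeasurableSpace A] (P : Measure (ℤ → A)) : Prop :=
  ∃ k : ℕ, ∀ (a : A) (s v : List A), s.length = k → s <:+ v → 0 < strProb P v →
    nextProb P v a = nextProb P s a

/-- The functional `F` on `𝒫`, with values in a metric space, is consistently estimable (in
probability): some sequence of statistics `F_n : A^n → E` satisfies
`d(F_n(X_1, …, X_n), F(P)) → 0` in `P`-probability for every `P` in `𝒫`. -/
def ConsistentlyEstimable {A E : Type*} [MeasurableSpace A] [MetricSpace E]
    (F : StationaryErgodic A → E) : Prop :=
  ∃ Fn : (n : ℕ) → (Fin n → A) → E, ∀ P : StationaryErgodic A,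
    TendstoInMeasure P.1 (fun (n : ℕ) (ω : ℤ → A) => Fn n (fun i => ω ((i : ℤ) + 1))) atTop
      (fun _ => F P)

/-!
The obstruction is a family of processes indexed by sets `S` of admissible lags. Let the pairs
`(K i, ξ i)`, `i ∈ ℤ`, be i.i.d. with a law of full support on `ℕ × A`. At time `i` the process
repeats the symbol it showed at time `i - K i` if `K i ∈ S` and `K i ≠ 0`, and shows `ξ i`
otherwise. Following the copies back in time, almost every lineage stops after finitely many steps
(`ae_exists_lineage_eq_zero`), so the process is a shift-equivariant measurable image of an i.i.d.
sequence, and inherits ergodicity from it (`ergodic_shift_iidLaw`, `ergodic_copyLaw`).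

The pair at time `0` is independent of the past, so that `P(a | s)` is known up to the probability
of a lag longer than `s` (`measure_forcing_le_nextProb`, `nextProb_le_measure_forcing_add`).
If `S` is finite, the chain is Markov and its context tree is finite (`determinesNext_copyLaw`). If
`S` is infinite, a run of the letter `a` far enough in the past still influences the next symbol,
so that no string is a context and every string is a node of the tree
(`not_determinesNext_copyLaw`, `treeNodes_eq_univ`).

All these processes live on one probability space. Adding only very long lags to a finite `S`
changes the first `n` symbols with small probability (`exists_lag_bound`), since the lineages of a
finite window meet long lags only rarely. Hence lags can be added to the empty set one by one, each
so long that a statistic which has almost settled on the value for the current finite set is still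
fooled by the final infinite set, at arbitrarily large times (`exists_infinite_forall`,
`not_consistentlyEstimable`).
-/

/-! ### Ergodicity of the Bernoulli shift -/

/-- The law of a two-sided i.i.d. sequence with marginal `ν`. -/
noncomputable abbrev iidLaw {E : Type*} [MeasurableSpace E] (ν : Measure E)
    [IsProbabilityMeasure ν] : Measure (ℤ → E) :=
  Measure.infinitePi fun _ => ν

theorem measurable_shift {E : Type*} [MeasurableSpace E] : Measurable (shift (A := E)) :=
  measurable_pi_lambda _ fun i => measurable_pi_apply (i + 1)

theorem shift_iterate {E : Type*} (n : ℕ) (ω : ℤ → E) (i : ℤ) :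
    shift^[n] ω i = ω (i + n) := by
  induction n generalizing ω with
  | zero => simp
  | succ n ih =>
    rw [Function.iterate_succ_apply, ih]
    simp [shift, add_assoc]

theorem iidLaw_map_shift {E : Type*} [MeasurableSpace E] (ν : Measure E)
    [IsProbabilityMeasure ν] : (iidLaw ν).map shift = iidLaw ν := by
  apply Measure.eq_infinitePi
  intro s t ht
  have hcancel (i : ℤ) : t (i + 1 - 1) = t i := congrArg t (add_sub_cancel_right i 1)
  have hpre : shift ⁻¹' (Set.pi (s : Set ℤ) t) =
      Set.pi ((s.map (addRightEmbedding (1 : ℤ)) : Finset ℤ) : Set ℤ)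
        (fun i => t (i - 1)) := by
    ext ω
    simp only [shift, Set.mem_preimage, Set.mem_pi, Finset.mem_coe, Finset.mem_map,
      addRightEmbedding_apply, forall_exists_index, and_imp, forall_apply_eq_imp_iff₂, hcancel]
  rw [Measure.map_apply measurable_shift
    (MeasurableSet.pi s.countable_toSet fun i _ => ht i), hpre,
    Measure.infinitePi_pi _ fun i _ => ht _, Finset.prod_map]
  exact Finset.prod_congr rfl fun i _ => congrArg ν (hcancel i)

/-- A cylinder is independent of its shift past its own window. -/
theorem exists_iidLaw_inter_shift {E : Type*} [MeasurableSpace E] (ν : Measure E)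
    [IsProbabilityMeasure ν] {t : Set (ℤ → E)} (ht : t ∈ measurableCylinders fun _ : ℤ => E) :
    ∃ n : ℕ, (iidLaw ν) (t ∩ shift^[n] ⁻¹' t) = (iidLaw ν) t * (iidLaw ν) t := by
  obtain ⟨I, S, hS, rfl⟩ := (mem_measurableCylinders t).1 ht
  set n : ℕ := 2 * I.sup Int.natAbs + 1 with hn
  refine ⟨n, ?_⟩
  have hmp : MeasurePreserving (shift (A := E)) (iidLaw ν) (iidLaw ν) :=
    ⟨measurable_shift, iidLaw_map_shift ν⟩
  have hI (i : ℤ) (hi : i ∈ I) : i.natAbs ≤ I.sup Int.natAbs := Finset.le_sup hi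
  set J : Finset ℤ := I.map (addRightEmbedding (n : ℤ)) with hJ
  have hdisj : Disjoint I J := by
    rw [Finset.disjoint_left]
    intro i hi hi'
    obtain ⟨j, hj, hji⟩ := Finset.mem_map.1 hi'
    have h1 := hI i hi
    have h2 := hI j hj
    simp only [addRightEmbedding_apply] at hji
    omega
  have hind : iIndepFun (fun (i : ℤ) (ω : ℤ → E) => ω i) (iidLaw ν) :=
    iIndepFun_infinitePi (P := fun _ : ℤ => ν) (X := fun _ x => x) fun _ => measurable_id
  have h2 := (hind.indepFun_finset I J hdisj fun i => measurable_pi_apply i).comp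
    (φ := id) (ψ := fun (f : J → E) (i : I) => f ⟨i + n, by
      rw [hJ, Finset.mem_map]; exact ⟨i, i.2, rfl⟩⟩) measurable_id
      (measurable_pi_lambda _ fun i => measurable_pi_apply _)
  have h3 := h2.measure_inter_preimage_eq_mul S S hS hS
  have hpre : shift^[n] ⁻¹' (cylinder I S) = ((fun (f : J → E) (i : I) => f ⟨i + n, by
      rw [hJ, Finset.mem_map]; exact ⟨i, i.2, rfl⟩⟩) ∘ fun (ω : ℤ → E) (i : J) => ω i) ⁻¹' S := by
    ext ω
    simp only [Set.mem_preimage, mem_cylinder, Function.comp_def]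
    rw [show I.restrict (shift^[n] ω) = fun i : I => ω (i + n) from
      funext fun i => shift_iterate n ω i]
  rw [← hpre] at h3
  have h4 := (hmp.iterate n).measure_preimage (s := cylinder I S)
    (hS.cylinder).nullMeasurableSet
  rw [h4] at h3
  exact h3

/-- The i.i.d. shift is ergodic: an invariant event is close to a cylinder `t`, hence to
`t ∩ shift⁻ⁿ t`, so that its probability `p` satisfies `p = p²`. -/
theorem ergodic_shift_iidLaw {E : Type*} [MeasurableSpace E] (ν : Measure E)
    [IsProbabilityMeasure ν] : Ergodic shift (iidLaw ν) := by
  have hmp : MeasurePreserving (shift (A := E)) (iidLaw ν) (iidLaw ν) :=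
    ⟨measurable_shift, iidLaw_map_shift ν⟩
  refine ⟨hmp, ⟨fun s hs hinv => ?_⟩⟩
  set μ := iidLaw ν with hμ
  have hinv' (n : ℕ) : shift^[n] ⁻¹' s = s := by
    induction n with
    | zero => rfl
    | succ n ih => rw [Function.iterate_succ, Set.preimage_comp, ih, hinv]
  have key (ε : ℝ) (hε : 0 < ε) : |μ.real s - μ.real s * μ.real s| ≤ 0 + ε := by
    obtain ⟨t, htC, ht⟩ := exists_measure_symmDiff_lt_of_generateFrom_isSetRing (μ := μ)
      (isSetRing_measurableCylinders (α := fun _ : ℤ => E))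
      ⟨{Set.univ}, Set.countable_singleton _,
        Set.singleton_subset_iff.2 (univ_mem_measurableCylinders fun _ : ℤ => E),
        by simp⟩ generateFrom_measurableCylinders.symm hs
      (ε := ENNReal.ofReal (ε / 5)) (by simpa using hε)
    have htm : MeasurableSet t := .of_mem_measurableCylinders htC
    obtain ⟨n, hn⟩ := exists_iidLaw_inter_shift ν htC
    have hd : μ.real (symmDiff t s) ≤ ε / 5 := by
      rw [Measure.real]
      exact ENNReal.toReal_le_of_le_ofReal (by positivity) ht.le
    have hd' : μ.real (symmDiff (shift^[n] ⁻¹' t) s) ≤ ε / 5 := by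
      have : symmDiff (shift^[n] ⁻¹' t) s = shift^[n] ⁻¹' (symmDiff t s) := by
        conv_lhs => rw [← hinv' n]
        rfl
      rw [this, Measure.real, (hmp.iterate n).measure_preimage
        (htm.symmDiff hs).nullMeasurableSet]
      exact hd
    have hreal : μ.real (t ∩ shift^[n] ⁻¹' t) = μ.real t * μ.real t := by
      simp [Measure.real, hμ, hn]
    have hsub : symmDiff (t ∩ shift^[n] ⁻¹' t) s ⊆
        symmDiff t s ∪ symmDiff (shift^[n] ⁻¹' t) s := by
      intro x
      simp only [Set.mem_symmDiff, Set.mem_inter_iff, Set.mem_union]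
      tauto
    have htm' : MeasurableSet (shift^[n] ⁻¹' t) := (hmp.iterate n).measurable htm
    have h1 := abs_measureReal_sub_le_measureReal_symmDiff (μ := μ)
      (htm.inter htm').nullMeasurableSet hs.nullMeasurableSet
    have h2 := abs_measureReal_sub_le_measureReal_symmDiff (μ := μ)
      htm.nullMeasurableSet hs.nullMeasurableSet
    have h3 := (measureReal_mono (μ := μ) hsub).trans (measureReal_union_le _ _)
    have hs0 : 0 ≤ μ.real s := measureReal_nonneg
    have hs1 : μ.real s ≤ 1 := measureReal_le_one
    have ht0 : 0 ≤ μ.real t := measureReal_nonneg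
    have ht1 : μ.real t ≤ 1 := measureReal_le_one
    rw [hreal] at h1
    have h1' := abs_le.1 h1
    have h2' := abs_le.1 h2
    rw [abs_le]
    constructor <;> nlinarith
  have hz : μ.real s - μ.real s * μ.real s = 0 :=
    abs_nonpos_iff.1 (le_of_forall_pos_le_add key)
  have hfac : μ.real s * (1 - μ.real s) = 0 := by linarith
  rw [eventuallyConst_set']
  rcases mul_eq_zero.1 hfac with h | h
  · left
    rw [ae_eq_empty]
    simpa [Measure.real, ENNReal.toReal_eq_zero_iff] using h
  · right
    have h1 : μ.real s = 1 := by linarith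
    rw [ae_eq_univ, prob_compl_eq_zero_iff hs]
    rw [Measure.real, ENNReal.toReal_eq_one_iff] at h1
    exact h1

/-! ### The copying process -/

/-- In a field `η` of pairs `(lag, symbol)`, the site that `i` copies from. Lag `0` marks a site
that keeps its own symbol; such a site is a fixed point of this map. -/
def ancestor {A : Type*} (η : ℤ → ℕ × A) (i : ℤ) : ℤ := i - (η i).1

/-- The pairs `(lag, symbol)` met along the successive ancestors of `i`. -/
def lineage {A : Type*} (η : ℤ → ℕ × A) (i : ℤ) (n : ℕ) : ℕ × A := η ((ancestor η)^[n] i)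

open Classical in
/-- The symbol attached to the first lag `0`; an arbitrary symbol if there is no lag `0`. -/
noncomputable def rootSymbol {A : Type*} [Nonempty A] (f : ℕ → ℕ × A) : A :=
  if h : ∃ n, (f n).1 = 0 then (f (Nat.find h)).2 else Classical.arbitrary A

/-- The copying process driven by `η`: at time `i` it shows `(η i).2` if the lag `(η i).1` is `0`,
and repeats the symbol shown `(η i).1` units of time earlier otherwise. -/
noncomputable def copyProcess {A : Type*} [Nonempty A] (η : ℤ → ℕ × A) (i : ℤ) : A :=
  rootSymbol (lineage η i)

section Deterministic

variable {A : Type*}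

theorem lineage_succ (η : ℤ → ℕ × A) (i : ℤ) (n : ℕ) :
    lineage η i (n + 1) = lineage η (ancestor η i) n := rfl

/-- The lineage of `i` is read off from the sites up to `i`. -/
theorem lineage_congr {η η' : ℤ → ℕ × A} {i : ℤ} (h : ∀ j ≤ i, η j = η' j) :
    lineage η i = lineage η' i := by
  funext n
  induction n generalizing i with
  | zero => exact h i le_rfl
  | succ n ih =>
    have hanc : ancestor η i = ancestor η' i := by simp only [ancestor, h i le_rfl]
    rw [lineage_succ, lineage_succ, ← hanc]
    refine ih fun j hj => h j (hj.trans ?_)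
    simp [ancestor]

theorem lineage_shift (η : ℤ → ℕ × A) (i : ℤ) : lineage (shift η) i = lineage η (i + 1) := by
  funext n
  induction n generalizing i with
  | zero => rfl
  | succ n ih =>
    rw [lineage_succ, lineage_succ, ih]
    congr 1
    simp only [ancestor, shift]
    ring

variable [Nonempty A]

theorem rootSymbol_of_zero {f : ℕ → ℕ × A} (h : (f 0).1 = 0) : rootSymbol f = (f 0).2 := by
  have hex : ∃ n, (f n).1 = 0 := ⟨0, h⟩
  rw [rootSymbol, dif_pos hex, (Nat.find_eq_zero hex).2 h]

theorem rootSymbol_of_ne_zero {f : ℕ → ℕ × A} (h : (f 0).1 ≠ 0) :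
    rootSymbol f = rootSymbol fun n => f (n + 1) := by
  classical
  by_cases hex : ∃ n, (f (n + 1)).1 = 0
  · have hex' : ∃ n, (f n).1 = 0 := hex.imp' (· + 1) fun _ hn => hn
    rw [rootSymbol, rootSymbol, dif_pos hex, dif_pos hex', Nat.find_comp_succ hex' hex h]
  · have hex' : ¬ ∃ n, (f n).1 = 0 := by
      rintro ⟨_ | n, hn⟩
      exacts [h hn, hex ⟨n, hn⟩]
    rw [rootSymbol, rootSymbol, dif_neg hex, dif_neg hex']

theorem copyProcess_of_zero {η : ℤ → ℕ × A} {i : ℤ} (h : (η i).1 = 0) :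
    copyProcess η i = (η i).2 :=
  rootSymbol_of_zero (f := lineage η i) h

theorem copyProcess_ancestor (η : ℤ → ℕ × A) (i : ℤ) :
    copyProcess η (ancestor η i) = copyProcess η i := by
  by_cases h : (η i).1 = 0
  · simp [ancestor, h]
  · exact (rootSymbol_of_ne_zero (f := lineage η i) h).symm

theorem copyProcess_congr {η η' : ℤ → ℕ × A} {i : ℤ} (h : ∀ j ≤ i, η j = η' j) :
    copyProcess η i = copyProcess η' i :=
  congrArg rootSymbol (lineage_congr h)

theorem copyProcess_shift (η : ℤ → ℕ × A) : copyProcess (shift η) = shift (copyProcess η) :=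
  funext fun i => congrArg rootSymbol (lineage_shift η i)

/-- The symbol at `i` depends only on the lineage of `i` up to its first lag `0`. -/
theorem copyProcess_congr_of_root {η η' : ℤ → ℕ × A} (N : ℕ) {i : ℤ}
    (hroot : (lineage η i N).1 = 0)
    (h : ∀ n ≤ N, lineage η i n = η' ((ancestor η)^[n] i)) :
    copyProcess η' i = copyProcess η i := by
  induction N generalizing i with
  | zero =>
    have h0 : η i = η' i := h 0 le_rfl
    have hr : (η i).1 = 0 := hroot
    rw [copyProcess_of_zero hr, copyProcess_of_zero (h0 ▸ hr), h0]
  | succ N ih =>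
    have h0 : η i = η' i := h 0 (Nat.zero_le _)
    have hanc : ancestor η' i = ancestor η i := by simp only [ancestor, h0]
    rw [← copyProcess_ancestor η', ← copyProcess_ancestor η, hanc]
    exact ih hroot fun n hn => h (n + 1) (by omega)

end Deterministic

section Measurability

theorem measurable_eval_random_site {E : Type*} [MeasurableSpace E] :
    Measurable fun p : ℤ × (ℤ → E) => p.2 p.1 :=
  measurable_from_prod_countable_right fun i => measurable_pi_apply i

variable {A : Type*} [Countable A] [MeasurableSpace A] [DiscreteMeasurableSpace A]

theorem measurable_iterate_ancestor (i : ℤ) (n : ℕ) :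
    Measurable fun η : ℤ → ℕ × A => (ancestor η)^[n] i := by
  induction n with
  | zero => exact measurable_const
  | succ n ih =>
    simp only [Function.iterate_succ_apply']
    exact ih.sub ((Measurable.of_discrete (f := fun u : ℕ × A => (u.1 : ℤ))).comp
      (measurable_eval_random_site.comp (ih.prodMk measurable_id)))

theorem measurable_lineage (i : ℤ) (n : ℕ) :
    Measurable fun η : ℤ → ℕ × A => lineage η i n :=
  measurable_eval_random_site.comp ((measurable_iterate_ancestor i n).prodMk measurable_id)

theorem measurable_rootSymbol [Nonempty A] :
    Measurable (rootSymbol : (ℕ → ℕ × A) → A) := by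
  classical
  have heval (n : ℕ) (s : Set (ℕ × A)) : MeasurableSet {f : ℕ → ℕ × A | f n ∈ s} :=
    measurableSet_preimage (measurable_pi_apply n) .of_discrete
  have hset (n : ℕ) : MeasurableSet {f : ℕ → ℕ × A | (f n).1 = 0} := heval n {u | u.1 = 0}
  have hall (t : Set ℕ) : MeasurableSet {f : ℕ → ℕ × A | ∀ k ∈ t, (f k).1 ≠ 0} := by
    rw [show {f : ℕ → ℕ × A | ∀ k ∈ t, (f k).1 ≠ 0} = ⋂ k ∈ t, {f | (f k).1 = 0}ᶜ by
      ext; simp]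
    exact .biInter t.to_countable fun k _ => (hset k).compl
  have hnever : MeasurableSet {f : ℕ → ℕ × A | ∀ n, (f n).1 ≠ 0} := by simpa using hall Set.univ
  refine measurable_to_countable' fun a => ?_
  have heq : rootSymbol ⁻¹' {a} =
      (⋃ n : ℕ, {f : ℕ → ℕ × A | ((f n).1 = 0 ∧ ∀ k < n, (f k).1 ≠ 0) ∧ (f n).2 = a}) ∪
      {f : ℕ → ℕ × A | (∀ n, (f n).1 ≠ 0) ∧ Classical.arbitrary A = a} := by
    ext f
    simp only [Set.mem_preimage, Set.mem_singleton_iff, Set.mem_union, Set.mem_iUnion,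
      Set.mem_ofPred_eq]
    by_cases h : ∃ n, (f n).1 = 0
    · rw [rootSymbol, dif_pos h]
      constructor
      · exact fun ha => .inl ⟨_, ⟨Nat.find_spec h, fun k hk => Nat.find_min h hk⟩, ha⟩
      · rintro (⟨n, hn, ha⟩ | ⟨hn, -⟩)
        · rwa [(Nat.find_eq_iff h).2 hn]
        · exact absurd h (not_exists.2 hn)
    · rw [rootSymbol, dif_neg h]
      push Not at h
      constructor
      · exact fun ha => .inr ⟨h, ha⟩
      · rintro (⟨n, hn, -⟩ | ⟨-, ha⟩)
        exacts [absurd hn.1 (h n), ha]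
  rw [heq]
  exact .union (.iUnion fun n => .inter (.inter (hset n) (hall {k | k < n}))
    (heval n {u | u.2 = a})) (.inter hnever (.const _))

theorem measurable_copyProcess [Nonempty A] :
    Measurable (copyProcess : (ℤ → ℕ × A) → ℤ → A) :=
  measurable_pi_lambda _ fun i =>
    measurable_rootSymbol.comp (measurable_pi_lambda _ fun n => measurable_lineage i n)

end Measurability

/-! ### The law of the copying process and its conditional probabilities -/

/-- Here `V` is an event of the past of `i`: membership in it depends on the coordinates `j < i`. -/
theorem iidLaw_inter_past {E : Type*} [MeasurableSpace E] (ν : Measure E)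
    [IsProbabilityMeasure ν] (i : ℤ) {D : Set E} (hD : MeasurableSet D) {V : Set (ℤ → E)}
    (hV : MeasurableSet V)
    (hpast : ∀ ω ω' : ℤ → E, (∀ j < i, ω j = ω' j) → (ω ∈ V ↔ ω' ∈ V)) :
    iidLaw ν ({ω | ω i ∈ D} ∩ V) = ν D * iidLaw ν V := by
  classical
  obtain ⟨e⟩ := nonempty_of_isProbabilityMeasure ν
  have hind : iIndep (fun j : ℤ => MeasurableSpace.comap (fun ω : ℤ → E => ω j) inferInstance)
      (iidLaw ν) :=
    iIndepFun_infinitePi (P := fun _ : ℤ => ν) (X := fun _ x => x) fun _ => measurable_id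
  have hindep := indep_iSup_of_disjoint (fun j => (measurable_pi_apply j).comap_le) hind
    (S := {i}) (T := Set.Iio i) (by simp)
  have hDm : MeasurableSet[⨆ j ∈ ({i} : Set ℤ),
      MeasurableSpace.comap (fun ω : ℤ → E => ω j) inferInstance] {ω : ℤ → E | ω i ∈ D} := by
    rw [iSup_singleton]
    exact ⟨D, hD, rfl⟩
  -- Erasing the coordinates from `i` on does not change membership in `V`.
  have hpre : V = (fun (ω : ℤ → E) j => if j < i then ω j else e) ⁻¹' V := by
    ext ω
    exact hpast _ _ fun j hj => (if_pos hj).symm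
  have hVm : MeasurableSet[⨆ j ∈ Set.Iio i,
      MeasurableSpace.comap (fun ω : ℤ → E => ω j) inferInstance] V := by
    rw [hpre]
    refine @measurable_pi_lambda _ _ _ (_) _ _ (fun j => ?_) V hV
    by_cases hj : j < i
    · simp only [if_pos hj]
      exact (comap_measurable _).mono
        (le_biSup (fun j => MeasurableSpace.comap (fun ω : ℤ → E => ω j) inferInstance) hj) le_rfl
    · simp only [if_neg hj]
      exact @measurable_const _ _ _ (_) _
  rw [(Indep_iff _ _ _).1 hindep _ _ hDm hVm]
  congr 1
  exact (measurePreserving_eval_infinitePi (fun _ : ℤ => ν) i).measure_preimage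
    hD.nullMeasurableSet

section Forcing

variable {A : Type*}

/-- The pairs `(lag, symbol)` at time `0` that force the symbol `a` once the past ends in `s`. -/
def forcing (s : List A) (a : A) : Set (ℕ × A) :=
  {u | (u.1 = 0 ∧ u.2 = a) ∨ (0 < u.1 ∧ u.1 ≤ s.length ∧ s[s.length - u.1]? = some a)}

theorem mem_forcing_append_iff {t s : List A} {a : A} {u : ℕ × A} (hu : u.1 ≤ s.length) :
    u ∈ forcing (t ++ s) a ↔ u ∈ forcing s a := by
  have hidx : 0 < u.1 → (t ++ s)[(t ++ s).length - u.1]? = s[s.length - u.1]? := by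
    intro hpos
    rw [List.getElem?_append_right (by simp; omega)]
    congr 1
    simp only [List.length_append]
    omega
  simp only [forcing, Set.mem_ofPred_eq]
  refine or_congr_right (and_congr_right fun hpos => ?_)
  rw [hidx hpos]
  exact and_congr_left fun _ => by simp; omega

variable [Nonempty A]

theorem copyProcess_zero_eq_of_mem_forcing {η : ℤ → ℕ × A} {s : List A} {a : A}
    (hs : copyProcess η ∈ pastEvent s) (h : η 0 ∈ forcing s a) : copyProcess η 0 = a := by
  rcases h with ⟨h0, ha⟩ | ⟨hpos, hle, ha⟩
  · rw [copyProcess_of_zero h0, ha]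
  · obtain ⟨hlt, hget⟩ := List.getElem?_eq_some_iff.1 ha
    rw [← copyProcess_ancestor, ← hget, ← hs _ hlt]
    congr 1
    simp only [ancestor]
    omega

theorem mem_forcing_of_copyProcess_zero_eq {η : ℤ → ℕ × A} {s : List A} {a : A}
    (hs : copyProcess η ∈ pastEvent s) (ha : copyProcess η 0 = a) (hle : (η 0).1 ≤ s.length) :
    η 0 ∈ forcing s a := by
  rcases Nat.eq_zero_or_pos (η 0).1 with h0 | hpos
  · exact .inl ⟨h0, by rw [← copyProcess_of_zero h0, ha]⟩
  · have hlt : s.length - (η 0).1 < s.length := by omega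
    refine .inr ⟨hpos, hle, List.getElem?_eq_some_iff.2 ⟨hlt, ?_⟩⟩
    rw [← hs _ hlt, ← ha, ← copyProcess_ancestor η 0]
    congr 1
    simp only [ancestor]
    omega

end Forcing

section Law

variable {A : Type*} [Countable A] [MeasurableSpace A] [DiscreteMeasurableSpace A]

/-- The number of ancestors seen before the first lag `0` has a geometric tail. -/
theorem iidLaw_lineage_ne_zero_le (ν : Measure (ℕ × A)) [IsProbabilityMeasure ν] (N : ℕ) (i : ℤ) :
    iidLaw ν {η | ∀ n < N, (lineage η i n).1 ≠ 0} ≤ ν {u | u.1 ≠ 0} ^ N := by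
  induction N generalizing i with
  | zero => simp
  | succ N ih =>
    set V : ℤ → Set (ℤ → ℕ × A) := fun j => {η | ∀ n < N, (lineage η j n).1 ≠ 0} with hVdef
    have hVm (j : ℤ) : MeasurableSet (V j) := by
      rw [show V j = ⋂ n ∈ Set.Iio N, {η | lineage η j n ∈ {u : ℕ × A | u.1 ≠ 0}} by
        ext; simp [hVdef]]
      exact .biInter (Set.to_countable _) fun n _ =>
        measurableSet_preimage (measurable_lineage j n) .of_discrete
    have hsub : {η : ℤ → ℕ × A | ∀ n < N + 1, (lineage η i n).1 ≠ 0} ⊆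
        ⋃ k : ℕ, {η | η i ∈ {u : ℕ × A | u.1 = k + 1}} ∩ V (i - (k + 1 : ℕ)) := by
      intro η hη
      obtain ⟨k, hk⟩ := Nat.exists_eq_succ_of_ne_zero (hη 0 (Nat.succ_pos N))
      have hk' : (η i).1 = k + 1 := hk
      refine Set.mem_iUnion.2 ⟨k, hk', fun n hn => ?_⟩
      have := hη (n + 1) (by omega)
      rwa [lineage_succ, ancestor, hk'] at this
    calc iidLaw ν {η | ∀ n < N + 1, (lineage η i n).1 ≠ 0}
        ≤ ∑' k : ℕ, iidLaw ν
            ({η | η i ∈ {u : ℕ × A | u.1 = k + 1}} ∩ V (i - (k + 1 : ℕ))) :=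
          (measure_mono hsub).trans (measure_iUnion_le _)
      _ ≤ ∑' k : ℕ, ν {u | u.1 = k + 1} * ν {u | u.1 ≠ 0} ^ N := by
          refine ENNReal.tsum_le_tsum fun k => ?_
          rw [iidLaw_inter_past ν i .of_discrete (hVm _)]
          · gcongr
            exact ih _
          · intro ω ω' h
            have hl : lineage ω (i - (k + 1 : ℕ)) = lineage ω' (i - (k + 1 : ℕ)) :=
              lineage_congr fun j hj => h j (by push_cast at hj; omega)
            simp only [hVdef, Set.mem_ofPred_eq, hl]
      _ = ν {u | u.1 ≠ 0} ^ (N + 1) := by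
          rw [ENNReal.tsum_mul_right, pow_succ', ← measure_iUnion
            (fun k l hkl => Set.disjoint_left.2 fun u hu hu' => hkl ?_) fun _ => .of_discrete]
          · congr 2
            ext u
            simp only [Set.mem_iUnion, Set.mem_ofPred_eq]
            constructor
            · rintro ⟨k, hk⟩
              omega
            · exact fun hu => ⟨u.1 - 1, by omega⟩
          · simp only [Set.mem_ofPred_eq] at hu hu'
            omega

/-- Almost every lineage reaches a lag `0`. -/
theorem ae_exists_lineage_eq_zero (ν : Measure (ℕ × A)) [IsProbabilityMeasure ν]
    (h0 : ν {u | u.1 = 0} ≠ 0) : ∀ᵐ η ∂iidLaw ν, ∀ i, ∃ N, (lineage η i N).1 = 0 := by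
  rw [ae_all_iff]
  intro i
  have hlt : ν {u | u.1 ≠ 0} < 1 := by
    rw [← Set.compl_ofPred, prob_compl_eq_one_sub .of_discrete]
    exact ENNReal.sub_lt_self ENNReal.one_ne_top one_ne_zero h0
  rw [ae_iff]
  refine le_antisymm (ge_of_tendsto' (ENNReal.tendsto_pow_atTop_nhds_zero_of_lt_one hlt)
    fun N => (measure_mono fun η hη n _ => ?_).trans (iidLaw_lineage_ne_zero_le ν N i)) zero_le
  exact fun h => hη ⟨n, h⟩

theorem measurableSet_pastEvent (s : List A) : MeasurableSet (pastEvent s) := by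
  rw [show pastEvent s = ⋂ i : Fin s.length,
      (fun ω : ℤ → A => ω ((i : ℤ) - s.length)) ⁻¹' {s[i]} by
    ext ω
    simp [pastEvent, Fin.forall_iff]]
  exact .iInter fun i => measurable_pi_apply _ (measurableSet_singleton _)

variable [Nonempty A]

/-- The law of the copying process driven by i.i.d. pairs `(lag, symbol)` of law `ν`. -/
noncomputable def copyLaw (ν : Measure (ℕ × A)) [IsProbabilityMeasure ν] : Measure (ℤ → A) :=
  (iidLaw ν).map copyProcess

instance (ν : Measure (ℕ × A)) [IsProbabilityMeasure ν] : IsProbabilityMeasure (copyLaw ν) :=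
  Measure.isProbabilityMeasure_map measurable_copyProcess.aemeasurable

theorem ergodic_copyLaw (ν : Measure (ℕ × A)) [IsProbabilityMeasure ν] :
    Ergodic shift (copyLaw ν) :=
  MeasurePreserving.ergodic_of_ergodic_semiconj ⟨measurable_copyProcess, rfl⟩
    (ergodic_shift_iidLaw ν) measurable_shift copyProcess_shift

/-- If symbols of their own are possible for every letter, every string has positive probability:
all its sites may show their own symbols. -/
theorem strProb_copyLaw_pos {ν : Measure (ℕ × A)} [IsProbabilityMeasure ν]
    (h0 : ∀ a, ν {(0, a)} ≠ 0) (s : List A) : 0 < strProb (copyLaw ν) s := by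
  have hsub : Set.pi ((Finset.Ico (-(s.length : ℤ)) 0 : Finset ℤ) : Set ℤ)
      (fun i => {(0, s[(i + s.length).toNat]?.getD (Classical.arbitrary A))}) ⊆
      copyProcess ⁻¹' pastEvent s := by
    intro η hη i hi
    have h := hη ((i : ℤ) - s.length) (by simp; omega)
    simp only [sub_add_cancel, Int.toNat_natCast, List.getElem?_eq_getElem hi, Option.getD_some,
      Set.mem_singleton_iff] at h
    rw [copyProcess_of_zero (by rw [h]), h]
  rw [strProb, copyLaw, Measure.map_apply measurable_copyProcess (measurableSet_pastEvent s)]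
  refine lt_of_lt_of_le ?_ (measure_mono hsub)
  rw [Measure.infinitePi_pi _ fun i _ => measurableSet_singleton _, pos_iff_ne_zero,
    Finset.prod_ne_zero_iff]
  exact fun i _ => h0 _

/-- Given the past `s`, the pair at time `0` still has law `ν`. -/
theorem iidLaw_inter_copyProcess_pastEvent (ν : Measure (ℕ × A)) [IsProbabilityMeasure ν]
    (s : List A) (D : Set (ℕ × A)) :
    iidLaw ν ({η | η 0 ∈ D} ∩ copyProcess ⁻¹' pastEvent s) = ν D * strProb (copyLaw ν) s := by
  rw [iidLaw_inter_past ν 0 .of_discrete (measurable_copyProcess (measurableSet_pastEvent s)),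
    strProb, copyLaw, Measure.map_apply measurable_copyProcess (measurableSet_pastEvent s)]
  intro ω ω' h
  refine forall_congr' fun i => forall_congr' fun hi => ?_
  rw [copyProcess_congr fun j hj => h j (by omega)]

theorem nextProb_copyLaw (ν : Measure (ℕ × A)) [IsProbabilityMeasure ν] (s : List A) (a : A) :
    nextProb (copyLaw ν) s a = (strProb (copyLaw ν) s)⁻¹ *
      iidLaw ν (copyProcess ⁻¹' pastEvent s ∩ {η | copyProcess η 0 = a}) := by
  have ha : MeasurableSet {ω : ℤ → A | ω 0 = a} :=
    (measurable_pi_apply (X := fun _ : ℤ => A) 0) (measurableSet_singleton a)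
  rw [nextProb, cond_apply (measurableSet_pastEvent s)]
  nth_rw 2 [copyLaw]
  rw [Measure.map_apply measurable_copyProcess ((measurableSet_pastEvent s).inter ha)]
  rfl

theorem measure_forcing_le_nextProb (ν : Measure (ℕ × A)) [IsProbabilityMeasure ν] {s : List A}
    (hs : 0 < strProb (copyLaw ν) s) (a : A) :
    ν (forcing s a) ≤ nextProb (copyLaw ν) s a := by
  have hne : strProb (copyLaw ν) s ≠ ∞ := measure_ne_top _ _
  rw [nextProb_copyLaw, mul_comm, ← div_eq_mul_inv, ENNReal.le_div_iff_mul_le (.inl hs.ne')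
    (.inl hne), ← iidLaw_inter_copyProcess_pastEvent]
  exact measure_mono fun η hη => ⟨hη.2, copyProcess_zero_eq_of_mem_forcing hη.2 hη.1⟩

theorem nextProb_le_measure_forcing_add (ν : Measure (ℕ × A)) [IsProbabilityMeasure ν]
    (s : List A) (a : A) :
    nextProb (copyLaw ν) s a ≤ ν (forcing s a) + ν {u | s.length < u.1} := by
  have hne : strProb (copyLaw ν) s ≠ ∞ := measure_ne_top _ _
  rw [nextProb_copyLaw, mul_comm, ← div_eq_mul_inv]
  refine ENNReal.div_le_of_le_mul ((measure_mono fun η hη => ?_).trans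
    ((iidLaw_inter_copyProcess_pastEvent ν s (forcing s a ∪ {u | s.length < u.1})).le.trans
      (mul_le_mul_left (measure_union_le _ _) _)))
  refine ⟨?_, hη.1⟩
  rcases lt_or_ge s.length (η 0).1 with h | h
  · exact .inr h
  · exact .inl (mem_forcing_of_copyProcess_zero_eq hη.1 hη.2 h)

end Law

/-! ### Context trees with bounded and with unbounded memory -/

section Tree

variable {A : Type*}

theorem length_pastSuffix (x : ℕ → A) (n : ℕ) : (pastSuffix x n).length = n := by
  simp [pastSuffix]

theorem eq_pastSuffix_of_suffix {x : ℕ → A} {n : ℕ} {u : List A} (h : u <:+ pastSuffix x n) :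
    u = pastSuffix x u.length := by
  have hlen : u.length ≤ n := by simpa [length_pastSuffix] using h.length_le
  have h' : u.reverse <+: (List.range n).map x := by
    rwa [← List.reverse_suffix, List.reverse_reverse]
  rw [List.prefix_iff_eq_take, ← List.map_take, List.take_range, List.length_reverse,
    min_eq_left hlen] at h'
  rw [pastSuffix, ← h', List.reverse_reverse]

theorem exists_eq_pastSuffix [Nonempty A] (v : List A) :
    ∃ x : ℕ → A, v = pastSuffix x v.length := by
  refine ⟨fun j => v.reverse[j]?.getD (Classical.arbitrary A), ?_⟩
  rw [pastSuffix, ← List.reverse_eq_iff]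
  refine List.ext_getElem (by simp) fun i h _ => ?_
  simp [List.getElem?_eq_getElem h]

variable [MeasurableSpace A] {P : Measure (ℤ → A)}

theorem isMarkov_iff_exists_determinesNext :
    IsMarkov P ↔ ∃ k : ℕ, ∀ s : List A, s.length = k → DeterminesNext P s :=
  exists_congr fun _ => ⟨fun h s hs a v => h a s v hs, fun h a s v hs => h s hs a v⟩

theorem hasFiniteContextTree_of_determinesNext [Finite A] {k : ℕ}
    (h : ∀ s : List A, s.length = k → DeterminesNext P s) : HasFiniteContextTree P := by
  classical
  have hctx (s : List A) (hs : IsContext P s) : s.length ≤ k := by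
    by_contra! hlt
    refine hs.2.2 _ (List.drop_suffix (s.length - k) s) (fun heq => ?_)
      (h _ (by rw [List.length_drop]; omega))
    have := congrArg List.length heq
    rw [List.length_drop] at this
    omega
  have hinf (x : ℕ → A) : ¬ IsInfiniteContext P x := by
    intro hx
    -- The shortest suffix of `x` that determines the next symbol is a context.
    have hex : ∃ n, DeterminesNext P (pastSuffix x n) := ⟨k, h _ (length_pastSuffix x k)⟩
    refine (hx (Nat.find hex)).2 ⟨.inl (hx _).1, Nat.find_spec hex, fun u hu hne hdet => ?_⟩
    have hux := eq_pastSuffix_of_suffix hu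
    have hle := hu.length_le
    rw [length_pastSuffix] at hle
    rcases hle.lt_or_eq with hlt | heq
    · exact Nat.find_min hex hlt (hux ▸ hdet)
    · exact hne (hux.trans (by rw [heq]))
  refine (List.finite_length_le A k).subset ?_
  rintro v (⟨s, hs, hvs⟩ | ⟨x, hx, -⟩)
  · exact hvs.length_le.trans (hctx s hs)
  · exact absurd hx (hinf x)

/-- If no string determines the next symbol then every left-infinite sequence is an infinite
context. -/
theorem treeNodes_eq_univ [Nonempty A] (hpos : ∀ s : List A, 0 < strProb P s)
    (h : ∀ s : List A, ¬ DeterminesNext P s) : treeNodes (contextTree P) = Set.univ := by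
  refine Set.eq_univ_of_forall fun v => .inr ?_
  obtain ⟨x, hx⟩ := exists_eq_pastSuffix v
  exact ⟨x, fun n => ⟨hpos _, fun hc => h _ hc.2.1⟩, v.length, hx⟩

end Tree

section CopyTree

variable {A : Type*} [Countable A] [MeasurableSpace A] [DiscreteMeasurableSpace A] [Nonempty A]
  {ν : Measure (ℕ × A)} [IsProbabilityMeasure ν]

/-- With lags at most `|s|`, the string `s` forces all there is to know. -/
theorem determinesNext_copyLaw (h0 : ∀ a, ν {(0, a)} ≠ 0) {s : List A}
    (hs : ν {u | s.length < u.1} = 0) : DeterminesNext (copyLaw ν) s := by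
  rintro a v ⟨t, rfl⟩ -
  have hnext (t : List A) :
      nextProb (copyLaw ν) (t ++ s) a = ν (forcing (t ++ s) a) := by
    have hlong : ν {u | (t ++ s).length < u.1} = 0 :=
      measure_mono_null (fun u (hu : (t ++ s).length < u.1) =>
        (List.suffix_append t s).length_le.trans_lt hu) hs
    refine le_antisymm ((nextProb_le_measure_forcing_add ν _ a).trans_eq ?_)
      (measure_forcing_le_nextProb ν (strProb_copyLaw_pos h0 _) a)
    rw [hlong, add_zero]
  have hlag : ∀ᵐ u ∂ν, u.1 ≤ s.length := by simpa [ae_iff] using hs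
  rw [hnext t, ← List.nil_append s, hnext [], List.nil_append]
  refine measure_congr ?_
  filter_upwards [hlag] with u hu
  exact propext (mem_forcing_append_iff hu)

/-- With unbounded lags, prefixing `s` with a long enough run of one letter `a` makes `a` more
likely than prefixing it with a run of another letter. -/
theorem not_determinesNext_copyLaw [Nontrivial A] (h0 : ∀ a, ν {(0, a)} ≠ 0)
    (hν : ∀ m : ℕ, ν {u | m < u.1} ≠ 0) (s : List A) : ¬ DeterminesNext (copyLaw ν) s := by
  intro hdet
  obtain ⟨a, b, hab⟩ := exists_pair_ne A
  obtain ⟨k, hk, hνk⟩ : ∃ k, s.length < k ∧ ν {u | u.1 = k} ≠ 0 := by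
    by_contra! hcon
    refine hν s.length (measure_mono_null (t := ⋃ k ∈ Set.Ioi s.length, {u | u.1 = k})
      (fun u hu => by simpa using hu) ?_)
    exact (measure_biUnion_null_iff (Set.to_countable _)).2 hcon
  have htail : Tendsto (fun m : ℕ => ν {u | m < u.1}) atTop (𝓝 0) := by
    have h := tendsto_measure_iInter_atTop (μ := ν) (s := fun m : ℕ => {u : ℕ × A | m < u.1})
      (fun _ => MeasurableSet.of_discrete.nullMeasurableSet)
      (fun m n hmn u (hu : n < u.1) => lt_of_le_of_lt hmn hu) ⟨0, measure_ne_top _ _⟩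
    rwa [show ⋂ m : ℕ, {u : ℕ × A | m < u.1} = ∅ from
      Set.eq_empty_of_forall_notMem fun u hu => lt_irrefl u.1 (Set.mem_iInter.1 hu u.1),
      measure_empty] at h
  obtain ⟨m, hm, hkm⟩ := ((htail.eventually (gt_mem_nhds (pos_iff_ne_zero.2 hνk))).and
    (eventually_ge_atTop k)).exists
  set va := List.replicate m a ++ s with hva
  set vb := List.replicate m b ++ s with hvb
  have hget (c : A) (j : ℕ) (hj : s.length < j) (hjm : j ≤ m + s.length) :
      (List.replicate m c ++ s)[m + s.length - j]? = some c := by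
    rw [List.getElem?_append_left (by simp; omega), List.getElem?_replicate_of_lt (by omega)]
  have hlen (c : A) : (List.replicate m c ++ s).length = m + s.length := by simp
  have hforce : forcing vb a ∪ {u | u.1 = k} ⊆ forcing va a := by
    rintro u (hu | hu)
    · rcases le_or_gt u.1 s.length with hle | hlt
      · exact (mem_forcing_append_iff hle).2 ((mem_forcing_append_iff hle).1 hu)
      · rcases hu with ⟨hz, -⟩ | ⟨-, hle, hb⟩
        · omega
        · rw [hlen] at hle
          rw [hvb, hlen, hget b _ hlt hle] at hb
          exact absurd (Option.some_injective _ hb) hab.symm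
    · have huk : u.1 = k := hu
      refine .inr ⟨by omega, ?_, ?_⟩
      · rw [hlen]
        omega
      · rw [hva, hlen, hget a _ (by omega) (by omega)]
  have hdisj : Disjoint (forcing vb a) {u | u.1 = k} := by
    rw [Set.disjoint_left]
    rintro u (⟨hz, -⟩ | ⟨-, -, hb⟩) hu
    · have huk : u.1 = k := hu
      omega
    · have huk : u.1 = k := hu
      rw [hvb, hlen, hget b _ (by omega) (by omega)] at hb
      exact hab (Option.some_injective _ hb).symm
  have hpos := strProb_copyLaw_pos h0
  have heq : nextProb (copyLaw ν) va a = nextProb (copyLaw ν) vb a :=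
    (hdet a va (List.suffix_append _ _) (hpos _)).trans
      (hdet a vb (List.suffix_append _ _) (hpos _)).symm
  have hchain : ν (forcing vb a) + ν {u | u.1 = k} ≤ ν (forcing vb a) + ν {u | m < u.1} :=
    calc ν (forcing vb a) + ν {u | u.1 = k} = ν (forcing vb a ∪ {u | u.1 = k}) :=
          (measure_union hdisj .of_discrete).symm
      _ ≤ ν (forcing va a) := measure_mono hforce
      _ ≤ nextProb (copyLaw ν) va a := measure_forcing_le_nextProb ν (hpos _) a
      _ = nextProb (copyLaw ν) vb a := heq
      _ ≤ ν (forcing vb a) + ν {u | vb.length < u.1} := nextProb_le_measure_forcing_add ν _ a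
      _ ≤ ν (forcing vb a) + ν {u | m < u.1} := by
          gcongr
          rw [hlen]
          omega
  exact hm.not_ge ((ENNReal.add_le_add_iff_left (measure_ne_top _ _)).1 hchain)

end CopyTree

/-! ### Thinning the lags -/

open Classical in
/-- Replace the lags outside `S` by `0`. -/
noncomputable def thin {A : Type*} (S : Set ℕ) (u : ℕ × A) : ℕ × A :=
  (if u.1 ∈ S then u.1 else 0, u.2)

theorem thin_congr {A : Type*} {S S' : Set ℕ} {u : ℕ × A} (h : u.1 ∈ S' ↔ u.1 ∈ S) :
    thin S' u = thin S u := by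
  by_cases hS : u.1 ∈ S
  · simp [thin, hS, h.2 hS]
  · simp [thin, hS, mt h.1 hS]

theorem exists_isProbabilityMeasure_singleton_ne_zero (E : Type*) [Countable E] [Nonempty E]
    [MeasurableSpace E] [MeasurableSingletonClass E] :
    ∃ ν : Measure E, IsProbabilityMeasure ν ∧ ∀ x, ν {x} ≠ 0 := by
  obtain ⟨w, hw, hsum⟩ := ENNReal.exists_pos_sum_of_countable' one_ne_zero E
  have h0 : ∑' x, w x ≠ 0 := fun h =>
    (hw (Classical.arbitrary E)).ne' (ENNReal.tsum_eq_zero.1 h _)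
  have htop : ∑' x, w x ≠ ∞ := hsum.ne_top
  refine ⟨(PMF.normalize w h0 htop).toMeasure, inferInstance, fun x => ?_⟩
  rw [PMF.toMeasure_apply_singleton _ _ (measurableSet_singleton x), PMF.normalize_apply]
  exact mul_ne_zero (hw x).ne' (ENNReal.inv_ne_zero.2 htop)

section ThinnedLaw

variable {A : Type*} [Countable A] [MeasurableSpace A] [DiscreteMeasurableSpace A]

/-- The law of the pair `(lag, symbol)` of law `ν` after thinning. -/
noncomputable def thinnedLaw (ν : Measure (ℕ × A)) (S : Set ℕ) : Measure (ℕ × A) :=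
  ν.map (thin S)

instance (ν : Measure (ℕ × A)) [IsProbabilityMeasure ν] (S : Set ℕ) :
    IsProbabilityMeasure (thinnedLaw ν S) :=
  Measure.isProbabilityMeasure_map Measurable.of_discrete.aemeasurable

theorem measurable_thin_comp (S : Set ℕ) :
    Measurable fun (η : ℤ → ℕ × A) i => thin S (η i) :=
  measurable_pi_lambda _ fun i =>
    (Measurable.of_discrete (f := thin S)).comp (measurable_pi_apply i)

theorem iidLaw_map_thin (ν : Measure (ℕ × A)) [IsProbabilityMeasure ν] (S : Set ℕ) :
    (iidLaw ν).map (fun η i => thin S (η i)) = iidLaw (thinnedLaw ν S) :=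
  Measure.infinitePi_map_pi (fun _ : ℤ => ν) (f := fun _ => thin S) fun _ => .of_discrete

theorem thinnedLaw_singleton_ne_zero {ν : Measure (ℕ × A)} (hν : ∀ u, ν {u} ≠ 0) (S : Set ℕ)
    (a : A) : thinnedLaw ν S {(0, a)} ≠ 0 := by
  rw [thinnedLaw, Measure.map_apply .of_discrete (measurableSet_singleton _)]
  refine fun h => hν (0, a) (measure_mono_null ?_ h)
  rintro _ rfl
  simp [thin]

theorem thinnedLaw_setOf_lt_ne_zero [Nonempty A] {ν : Measure (ℕ × A)} (hν : ∀ u, ν {u} ≠ 0)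
    {S : Set ℕ} (hS : S.Infinite) (m : ℕ) : thinnedLaw ν S {u | m < u.1} ≠ 0 := by
  obtain ⟨k, hkS, hk⟩ := hS.exists_gt m
  rw [thinnedLaw, Measure.map_apply .of_discrete .of_discrete]
  refine fun h => hν (k, Classical.arbitrary A) (measure_mono_null ?_ h)
  rintro _ rfl
  simp [thin, hkS, hk]

theorem exists_thinnedLaw_setOf_lt_eq_zero (ν : Measure (ℕ × A)) {S : Set ℕ} (hS : S.Finite) :
    ∃ m : ℕ, thinnedLaw ν S {u | m < u.1} = 0 := by
  obtain ⟨m, hm⟩ := hS.bddAbove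
  refine ⟨m, ?_⟩
  rw [thinnedLaw, Measure.map_apply .of_discrete .of_discrete]
  convert measure_empty (μ := ν)
  refine Set.eq_empty_of_forall_notMem fun u (hu : m < (thin S u).1) => ?_
  by_cases huS : u.1 ∈ S
  · rw [thin, if_pos huS] at hu
    exact (hm huS).not_gt hu
  · rw [thin, if_neg huS] at hu
    omega

variable [Nonempty A] {ν : Measure (ℕ × A)} [IsProbabilityMeasure ν]

/-- The copying process whose lags are confined to `S`, as a stationary ergodic process. -/
noncomputable def thinnedCopy (ν : Measure (ℕ × A)) [IsProbabilityMeasure ν] (S : Set ℕ) :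
    StationaryErgodic A :=
  ⟨copyLaw (thinnedLaw ν S), inferInstance, ergodic_copyLaw _⟩

theorem thinnedCopy_apply (S : Set ℕ) {B : Set (ℤ → A)} (hB : MeasurableSet B) :
    (thinnedCopy ν S).1 B = iidLaw ν {η | copyProcess (fun i => thin S (η i)) ∈ B} := by
  change copyLaw (thinnedLaw ν S) B = _
  rw [copyLaw, ← iidLaw_map_thin,
    Measure.map_map measurable_copyProcess (measurable_thin_comp S),
    Measure.map_apply (measurable_copyProcess.comp (measurable_thin_comp S)) hB]
  rfl

theorem determinesNext_thinnedCopy (hν : ∀ u, ν {u} ≠ 0) {S : Set ℕ} (hS : S.Finite) :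
    ∃ k : ℕ, ∀ s : List A, s.length = k → DeterminesNext (thinnedCopy ν S).1 s := by
  obtain ⟨m, hm⟩ := exists_thinnedLaw_setOf_lt_eq_zero ν hS
  refine ⟨m, ?_⟩
  rintro s rfl
  exact determinesNext_copyLaw (thinnedLaw_singleton_ne_zero hν S) hm

theorem not_determinesNext_thinnedCopy [Nontrivial A] (hν : ∀ u, ν {u} ≠ 0) {S : Set ℕ}
    (hS : S.Infinite) (s : List A) : ¬ DeterminesNext (thinnedCopy ν S).1 s :=
  not_determinesNext_copyLaw (thinnedLaw_singleton_ne_zero hν S)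
    (thinnedLaw_setOf_lt_ne_zero hν hS) s

theorem treeNodes_thinnedCopy [Nontrivial A] (hν : ∀ u, ν {u} ≠ 0) {S : Set ℕ}
    (hS : S.Infinite) : treeNodes (contextTree (thinnedCopy ν S).1) = Set.univ :=
  treeNodes_eq_univ (strProb_copyLaw_pos (thinnedLaw_singleton_ne_zero hν S))
    (not_determinesNext_thinnedCopy hν hS)

/-- Lags beyond a large `m` rarely matter in a fixed finite window: the lineages of the window are
almost surely finite, so that they only meet lags up to `m` with probability close to `1`. -/
theorem exists_lag_bound (hν : ∀ u, ν {u} ≠ 0) (S : Set ℕ) (I : Finset ℤ) {ε : ℝ≥0∞}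
    (hε : 0 < ε) : ∃ m : ℕ, ∀ S' : Set ℕ, (∀ j ≤ m, j ∈ S' ↔ j ∈ S) →
      iidLaw ν {η | ∃ i ∈ I, copyProcess (fun j => thin S' (η j)) i ≠
        copyProcess (fun j => thin S (η j)) i} ≤ ε := by
  set η' : (ℤ → ℕ × A) → ℤ → ℕ × A := fun η j => thin S (η j) with hη'
  -- `site η i n` is the unthinned pair at the `n`-th ancestor of `i`.
  set site : (ℤ → ℕ × A) → ℤ → ℕ → ℕ × A := fun η i n => η ((ancestor (η' η))^[n] i) with hsite
  have hsite' (η i n) : lineage (η' η) i n = thin S (site η i n) := rfl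
  set good : ℕ → Set (ℤ → ℕ × A) := fun m =>
    {η | ∀ i ∈ I, ∃ N ≤ m, (lineage (η' η) i N).1 = 0 ∧ ∀ n ≤ N, (site η i n).1 ≤ m} with hgood
  have hmono : Monotone good := by
    intro m m' hm η hη i hi
    obtain ⟨N, hN, hroot, hle⟩ := hη i hi
    exact ⟨N, hN.trans hm, hroot, fun n hn => (hle n hn).trans hm⟩
  have hae : iidLaw ν (⋃ m, good m)ᶜ = 0 := by
    have h0 : thinnedLaw ν S {u | u.1 = 0} ≠ 0 := fun h =>
      thinnedLaw_singleton_ne_zero hν S (Classical.arbitrary A)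
        (measure_mono_null (by rintro _ rfl; rfl) h)
    have h1 := ae_exists_lineage_eq_zero (thinnedLaw ν S) h0
    rw [← iidLaw_map_thin] at h1
    have h2 := ae_of_ae_map (measurable_thin_comp S).aemeasurable h1
    rw [← mem_ae_iff]
    filter_upwards [h2] with η hη
    choose N hN using hη
    set b : ℕ := I.sup fun i => N i + (Finset.range (N i + 1)).sup fun n => (site η i n).1
    refine Set.mem_iUnion.2 ⟨b, fun i hi => ?_⟩
    have hb : N i + (Finset.range (N i + 1)).sup (fun n => (site η i n).1) ≤ b :=
      Finset.le_sup (f := fun i => N i + (Finset.range (N i + 1)).sup fun n => (site η i n).1) hi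
    refine ⟨N i, (Nat.le_add_right _ _).trans hb, hN i, fun n hn => ?_⟩
    exact (Finset.le_sup (f := fun n => (site η i n).1)
      (Finset.mem_range.2 (Nat.lt_succ_of_le hn))).trans ((Nat.le_add_left _ _).trans hb)
  have hsm (i n) : Measurable fun η => site η i n := measurable_eval_random_site.comp
    (((measurable_iterate_ancestor i n).comp (measurable_thin_comp S)).prodMk measurable_id)
  have hmeas (m : ℕ) : MeasurableSet (good m) := by
    rw [show good m = ⋂ i ∈ I, ⋃ N ∈ Set.Iic m, (fun η => site η i N) ⁻¹' {u | (thin S u).1 = 0} ∩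
        ⋂ n ∈ Set.Iic N, (fun η => site η i n) ⁻¹' {u | u.1 ≤ m} by
      ext η
      simp [hgood, hsite', and_left_comm]]
    exact .biInter I.countable_toSet fun i _ => .biUnion (Set.to_countable _) fun N _ =>
      .inter (hsm i N .of_discrete) (.biInter (Set.to_countable _) fun n _ =>
        hsm i n .of_discrete)
  have htend : Tendsto (fun m => iidLaw ν (good m)ᶜ) atTop (𝓝 0) := by
    have h := tendsto_measure_iInter_atTop (μ := iidLaw ν) (s := fun m => (good m)ᶜ)
      (fun m => (hmeas m).compl.nullMeasurableSet)
      (fun m m' hm => Set.compl_subset_compl.2 (hmono hm)) ⟨0, measure_ne_top _ _⟩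
    rwa [← Set.compl_iUnion, hae] at h
  obtain ⟨m, hm⟩ := (htend.eventually (gt_mem_nhds hε)).exists
  refine ⟨m, fun S' hS' => (measure_mono fun η hη hmem => ?_).trans hm.le⟩
  obtain ⟨i, hi, hne⟩ := hη
  obtain ⟨N, -, hroot, hle⟩ := hmem i hi
  refine hne (copyProcess_congr_of_root N hroot fun n hn => ?_)
  exact (thin_congr (hS' _ (hle n hn))).symm

end ThinnedLaw

/-! ### The diagonal argument -/

/-- Let `p k` be properties of sets of naturals that near every finite set `S` hold on a whole
neighbourhood, all sets agreeing with `S` up to some bound. Then some infinite set has all of them: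
add elements to `∅` one by one, the `k`-th beyond the bound for `p k` at the current set. -/
theorem exists_infinite_forall {p : ℕ → Set ℕ → Prop}
    (h : ∀ k, ∀ S : Finset ℕ, ∃ m, ∀ S' : Set ℕ, (∀ j ≤ m, j ∈ S' ↔ j ∈ S) → p k S') :
    ∃ S : Set ℕ, S.Infinite ∧ ∀ k, p k S := by
  choose m hm using h
  set e : ℕ → Finset ℕ → ℕ := fun k S => m k S + S.sup id + 1 with he
  set T : ℕ → Finset ℕ := fun n => Nat.rec ∅ (fun k S => insert (e k S) S) n with hT
  have hTsucc (k : ℕ) : T (k + 1) = insert (e k (T k)) (T k) := rfl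
  have hTmono : Monotone T := monotone_nat_of_le_succ fun k => by
    rw [hTsucc]
    exact Finset.subset_insert _ _
  have hlt {k l : ℕ} (hkl : k < l) : e k (T k) < e l (T l) := by
    have hmem : e k (T k) ∈ T l :=
      hTmono (Nat.succ_le_of_lt hkl) (by rw [hTsucc]; exact Finset.mem_insert_self _ _)
    have := Finset.le_sup (f := id) hmem
    simp only [id] at this
    have hel : e l (T l) = m l (T l) + (T l).sup id + 1 := rfl
    omega
  refine ⟨⋃ k, (T k : Set ℕ), ?_, fun k => hm k (T k) _ fun j hj => ⟨fun hmem => ?_, fun hmem =>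
    Set.mem_iUnion.2 ⟨k, hmem⟩⟩⟩
  · refine Set.infinite_of_injective_forall_mem (f := fun k => e k (T k))
      (strictMono_nat_of_lt_succ fun k => hlt k.lt_succ_self).injective fun k =>
        Set.mem_iUnion.2 ⟨k + 1, ?_⟩
    rw [hTsucc]
    exact Finset.mem_insert_self _ _
  · obtain ⟨l, hl⟩ := Set.mem_iUnion.1 hmem
    have key (l : ℕ) : j ∈ T l → j ∈ T k := by
      induction l with
      | zero => exact fun hj0 => absurd hj0 (Finset.notMem_empty j)
      | succ l ih =>
        intro hjl
        rcases Finset.mem_insert.1 (hTsucc l ▸ hjl) with heq | hmem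
        · rcases lt_or_ge l k with hlk | hkl
          · exact hTmono (Nat.succ_le_of_lt hlk) hjl
          · have hle : e k (T k) ≤ e l (T l) := by
              rcases hkl.eq_or_lt with rfl | hkl
              exacts [le_rfl, (hlt hkl).le]
            have hek : e k (T k) = m k (T k) + (T k).sup id + 1 := rfl
            omega
        · exact ih hmem
    exact key l hl

/-- No statistic can tell finite from infinite memory within the family of thinned copying
processes. -/
theorem not_consistentlyEstimable {A : Type*} [Countable A] [Nontrivial A] [MeasurableSpace A]
    [DiscreteMeasurableSpace A] {ν : Measure (ℕ × A)} [IsProbabilityMeasure ν]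
    (hν : ∀ u, ν {u} ≠ 0) {F : StationaryErgodic A → ℝ}
    (hfin : ∀ S : Set ℕ, S.Finite → F (thinnedCopy ν S) = 1)
    (hinf : ∀ S : Set ℕ, S.Infinite → F (thinnedCopy ν S) = 0) :
    ¬ ConsistentlyEstimable F := by
  rintro ⟨Fn, hFn⟩
  -- The probability that the statistic at time `n` errs by at least `1/2` if the truth is `c`.
  set err : ℕ → ℝ → Set ℕ → ℝ≥0∞ := fun n c S => (thinnedCopy ν S).1
    {ω | 2⁻¹ ≤ edist (Fn n fun i => ω ((i : ℤ) + 1)) c} with herr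
  have herr_eq (n c S) : err n c S = iidLaw ν {η | 2⁻¹ ≤
      edist (Fn n fun i => copyProcess (fun j => thin S (η j)) ((i : ℤ) + 1)) c} := by
    refine thinnedCopy_apply S ?_
    have hwindow : Measurable fun (ω : ℤ → A) (i : Fin n) => ω ((i : ℤ) + 1) :=
      measurable_pi_lambda _ fun i => measurable_pi_apply _
    exact hwindow (MeasurableSet.of_discrete (s := {x | 2⁻¹ ≤ edist (Fn n x) c}))
  have hlim (S : Set ℕ) :
      Tendsto (fun n => err n (F (thinnedCopy ν S)) S) atTop (𝓝 0) :=
    hFn (thinnedCopy ν S) 2⁻¹ (by simp)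
  -- At the infinite `S` built here the statistic is within `1/2` of the wrong value `1` with
  -- probability at least `1/2`, at arbitrarily large times.
  obtain ⟨S, hS, hbad⟩ := exists_infinite_forall
      (p := fun k S => ∃ n ≥ k, err n 1 S ≤ 4⁻¹ + 4⁻¹) fun k S => by
    have h1 := hlim S
    rw [hfin S S.finite_toSet] at h1
    obtain ⟨n, hn, hkn⟩ := ((h1.eventually_lt_const (by simp : (0 : ℝ≥0∞) < 4⁻¹)).and
      (eventually_ge_atTop k)).exists
    obtain ⟨m, hm⟩ := exists_lag_bound hν (S : Set ℕ) (Finset.Icc 1 (n : ℤ)) (ε := 4⁻¹) (by simp)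
    refine ⟨m, fun S' hS' => ⟨n, hkn, ?_⟩⟩
    rw [herr_eq] at hn ⊢
    refine (measure_mono fun η hη => ?_).trans ((measure_union_le _ _).trans
      (add_le_add hn.le (hm S' hS')))
    by_contra hcon
    simp only [Set.mem_union, not_or, Set.mem_ofPred_eq, not_exists, not_and, not_not] at hcon
    refine hcon.1 ?_
    have heq : (fun i : Fin n => copyProcess (fun j => thin S' (η j)) ((i : ℤ) + 1)) =
        fun i : Fin n => copyProcess (fun j => thin (S : Set ℕ) (η j)) ((i : ℤ) + 1) :=
      funext fun i => hcon.2 _ (by rw [Finset.mem_Icc]; omega)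
    rw [← heq]
    exact hη
  have h0 := hlim S
  rw [hinf S hS] at h0
  obtain ⟨k, hk⟩ := eventually_atTop.1 (h0.eventually_lt_const (by simp : (0 : ℝ≥0∞) < 2⁻¹))
  obtain ⟨n, hkn, hn⟩ := hbad k
  have hcover : (1 : ℝ≥0∞) ≤ err n 1 S + err n 0 S := by
    refine le_trans ?_ (measure_union_le _ _)
    have := (thinnedCopy ν S).2.1
    rw [← measure_univ (μ := (thinnedCopy ν S).1)]
    refine measure_mono fun ω _ => ?_
    by_contra hcon
    simp only [Set.mem_union, not_or, Set.mem_ofPred_eq, not_le] at hcon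
    have htri := (edist_triangle_left (1 : ℝ) 0 (Fn n fun i => ω ((i : ℤ) + 1))).trans_lt
      (ENNReal.add_lt_add hcon.1 hcon.2)
    rw [ENNReal.inv_two_add_inv_two, edist_dist] at htri
    simp at htri
  have hquarter : (4⁻¹ + 4⁻¹ : ℝ≥0∞) = 2⁻¹ := by
    rw [← two_mul, show (4 : ℝ≥0∞) = 2 * 2 by norm_num, ENNReal.mul_inv (by simp) (by simp),
      ← mul_assoc, ENNReal.mul_inv_cancel (by simp) (by simp), one_mul]
  have hlt := ENNReal.add_lt_add_of_le_of_lt (ne_top_of_le_ne_top (by simp) hn) hn (hk n hkn)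
  rw [hquarter, ENNReal.inv_two_add_inv_two] at hlt
  exact hlt.not_ge hcover

theorem theorem2 (A : Type*) [Finite A] [Nontrivial A] [MeasurableSpace A]
    [DiscreteMeasurableSpace A] :
    (∀ φ : List A → ℝ≥0, ∑' v : List A, (φ v : ℝ≥0∞) = ∞ →
      ¬ ConsistentlyEstimable
        (Set.indicator
          {P : StationaryErgodic A | ∑' v : treeNodes (contextTree P.1), (φ v : ℝ≥0∞) < ∞}
          (fun _ => (1 : ℝ)))) ∧
    ¬ ConsistentlyEstimable
      (Set.indicator {P : StationaryErgodic A | HasFiniteContextTree P.1} (fun _ => (1 : ℝ))) ∧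
    ¬ ConsistentlyEstimable
      (Set.indicator {P : StationaryErgodic A | IsMarkov P.1} (fun _ => (1 : ℝ))) := by
  obtain ⟨ν, hprob, hν⟩ := exists_isProbabilityMeasure_singleton_ne_zero (ℕ × A)
  have main (Q : Set (StationaryErgodic A)) (hfin : ∀ S : Set ℕ, S.Finite → thinnedCopy ν S ∈ Q)
      (hinf : ∀ S : Set ℕ, S.Infinite → thinnedCopy ν S ∉ Q) :
      ¬ ConsistentlyEstimable (Q.indicator fun _ => (1 : ℝ)) :=
    not_consistentlyEstimable hν (fun S hS => Set.indicator_of_mem (hfin S hS) _)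
      fun S hS => Set.indicator_of_notMem (hinf S hS) _
  have htree (S : Set ℕ) (hS : S.Finite) : HasFiniteContextTree (thinnedCopy ν S).1 :=
    (determinesNext_thinnedCopy hν hS).elim fun _ hk => hasFiniteContextTree_of_determinesNext hk
  refine ⟨fun φ hφ => main _ (fun S hS => ?_) fun S hS => ?_,
    main _ htree fun S hS => ?_, main _ (fun S hS => ?_) fun S hS => ?_⟩
  · have := (htree S hS).to_subtype
    have := Fintype.ofFinite (treeNodes (contextTree (thinnedCopy ν S).1))
    simp only [Set.mem_ofPred_eq, tsum_fintype]
    exact ENNReal.sum_lt_top.2 fun _ _ => ENNReal.coe_lt_top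
  · change ¬ ∑' v : treeNodes (contextTree (thinnedCopy ν S).1), (φ v : ℝ≥0∞) < ∞
    rw [treeNodes_thinnedCopy hν hS, tsum_univ fun v : List A => (φ v : ℝ≥0∞), hφ]
    exact lt_irrefl _
  · change ¬ (treeNodes (contextTree (thinnedCopy ν S).1)).Finite
    rw [treeNodes_thinnedCopy hν hS]
    exact Set.infinite_univ
  · exact isMarkov_iff_exists_determinesNext.2 (determinesNext_thinnedCopy hν hS)
  · intro hM
    obtain ⟨k, hk⟩ := isMarkov_iff_exists_determinesNext.1 hM
    exact not_determinesNext_thinnedCopy hν hS _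
      (hk (List.replicate k (Classical.arbitrary A)) (by simp))
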